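/- Let $\Sigma$ be an algebraic signature (finitary operation symbols only) containing a constant symbol $\top$, let $\mathbf{K}$ be a quasivariety of $\Sigma$-algebras (a class axiomatized by quasi-identities), and let $X$ be an infinite set of variables, with $\mathrm{Fm}(X)$ the absolutely free $\Sigma$-algebra over $X$. For a $\Sigma$-algebra $A$ let $\mathrm{Co}_{\mathbf{K}}(A)$ be the algebraic lattice of congruences $\theta$ of $A$ with $A/\theta\in\mathbf{K}$, ordered by inclusion; it is contravariantly functorial in $A$ by inverse image. Let $(\mathrm{Co}_{\mathbf{K}},i)$ be the filter pair with $i$ given by the equation $x=\top$, i.e. $i_A(\theta)=\{a\in A \mid \langle a,\top\rangle\in\theta\}$, and let $l$ be its associated logic on $\mathrm{Fm}(X)$: $$\Gamma\vdash_l\varphi \iff \text{for all } \theta\in \mathrm{Co}_{\mathbf{K}}(\mathrm{Fm}(X)):\ \Gamma\subseteq i_{\mathrm{Fm}(X)}(\theta) \Rightarrow \varphi\in i_{\mathrm{Fm}(X)}(\theta).$$ For $F\subseteq A$ let $\Omega^A(F)$ denote the Leibniz congruence, the greatest congruence $\theta$ of $A$ compatible with $F$ (if $a\in F$ and $\langle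 a,b\rangle\in\theta$ then $b\in F$). An $l$-filter of $A$ is a subset $F\subseteq A$ such that whenever $\Gamma\vdash_l\varphi$ and $v:\mathrm{Fm}(X)\to A$ is a homomorphism with $v[\Gamma]\subseteq F$, then $v(\varphi)\in F$. The class of reduced algebras of $l$ is the class of all $\Sigma$-algebras $A$ that have an $l$-filter $F$ with $\Omega^A(F)=\{\langle a,a\rangle\mid a\in A\}$. Suppose that * $l$ is protoalgebraic, i.e. for every theory $T$ of $l$ and all $\langle\varphi,\psi\rangle\in\Omega^{\mathrm{Fm}(X)}(T)$ one has $T,\varphi\vdash_l\psi$ and $T,\psi\vdash_l\varphi$; and * the class of reduced algebras of $l$ coincides with $\mathbf{K}$. Then $l$ is algebraizable in the sense of Blok and Pigozzi, with equivalent algebraic semantics $\mathbf{K}$. That is, there are a finite set $\tau$ of equations $\delta(x)\approx\epsilon(x)$ in one variable and a finite set $\Delta(p,q)$ of formulas in two variables such that, writing $\tau(\varphi)=\{\delta(\varphi)\approx\epsilon(\varphi) \mid (\delta\approx\epsilon)\in\tau\}$, $\varphi\,\Delta\,\psi$ for the set of all substitution instances $\chi(\varphi,\psi)$ with $\chi\in\Delta$,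 and $\models_{\mathbf{K}}$ for equational consequence over $\mathbf{K}$ (a set on the right-hand side being read conjunctively), 1. $\Gamma\vdash_l\varphi \iff \bigcup_{\gamma\in\Gamma}\tau(\gamma)\models_{\mathbf{K}}\tau(\varphi)$ for all $\Gamma\cup\{\varphi\}\subseteq \mathrm{Fm}(X)$; 2. $\Gamma\models_{\mathbf{K}}\varphi\approx\psi \iff \bigcup_{(\xi\approx\eta)\in\Gamma}\xi\,\Delta\,\eta\vdash_l\varphi\,\Delta\,\psi$ for every set of equations $\Gamma$ and every equation $\varphi\approx\psi$ over $\mathrm{Fm}(X)$; 3. $\psi\dashv\vdash_l\bigcup_{(\xi\approx\eta)\in\tau(\psi)}\xi\,\Delta\,\eta$ for every $\psi\in \mathrm{Fm}(X)$. -/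

import Mathlib

universe u v w

namespace AAL

open FirstOrder FirstOrder.Language FirstOrder.Language.Structure CategoryTheory

/-! ## Algebras, formulas, congruences

A signature is a first-order language `L` without relation symbols (`L.IsAlgebraic`), an algebra is
an `L`-structure, and `L.Term X` is the absolutely free algebra `Fm(X)`.  A valuation of `Fm(X)` in
`A` is the evaluation `t ↦ t.realize v` given by a map `v : X → A`, and a substitution is
`t ↦ t.subst σ` given by a map `σ : X → L.Term X`. -/

section Algebra

variable {L : FirstOrder.Language.{u, v}} [L.IsAlgebraic]

/-- The algebra structure on the set of formulas. -/
instance termStructure (X : Type w) : L.Structure (L.Term X) where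
  funMap f ts := Term.func f ts
  RelMap r _ := isEmptyElim r

theorem realize_term_eq_subst {X Y : Type u} (σ : X → L.Term Y) (t : L.Term X) :
    t.realize σ = t.subst σ := by
  induction t with
  | var x => rfl
  | func f ts ih => simp only [Term.realize, Term.subst, ih]; rfl

/-- The substitution given by `σ`, as a homomorphism. -/
def substHom {X Y : Type u} (σ : X → L.Term Y) : L.Term X →[L] L.Term Y where
  toFun t := t.subst σ
  map_fun' _ _ := rfl
  map_rel' r _ := isEmptyElim r

variable (L) in
/-- A congruence of the algebra `A`. -/
@[ext]
structure Con (A : Type u) [L.Structure A] extends Setoid A where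
  funMap_rel : ∀ {n : ℕ} (f : L.Functions n) (x y : Fin n → A),
    (∀ i, toSetoid.r (x i) (y i)) → toSetoid.r (funMap f x) (funMap f y)

namespace Con

variable {A : Type u} [L.Structure A] {B : Type u} [L.Structure B]

/-- `θ.Rel a b` means `⟨a, b⟩ ∈ θ`. -/
def Rel (θ : Con L A) (a b : A) : Prop := θ.toSetoid.r a b

theorem refl (θ : Con L A) (a : A) : θ.Rel a a := θ.toSetoid.iseqv.refl a

theorem symm (θ : Con L A) {a b : A} (h : θ.Rel a b) : θ.Rel b a := θ.toSetoid.iseqv.symm h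

theorem trans (θ : Con L A) {a b c : A} (h : θ.Rel a b) (h' : θ.Rel b c) : θ.Rel a c :=
  θ.toSetoid.iseqv.trans h h'

theorem ext_rel {θ θ' : Con L A} (h : ∀ a b, θ.Rel a b ↔ θ'.Rel a b) : θ = θ' :=
  Con.ext (funext fun a => funext fun b => propext (h a b))

/-- Congruences are ordered by inclusion. -/
instance : PartialOrder (Con L A) where
  le θ θ' := ∀ a b, θ.Rel a b → θ'.Rel a b
  le_refl _ _ _ h := h
  le_trans _ _ _ h h' a b x := h' a b (h a b x)
  le_antisymm _ _ h h' := ext_rel fun a b => ⟨h a b, h' a b⟩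

variable (L A) in
/-- The diagonal of `A`. -/
def diag : Con L A where
  r a b := a = b
  iseqv := ⟨fun _ => rfl, Eq.symm, Eq.trans⟩
  funMap_rel f _ _ h := congrArg (funMap f) (funext h)

theorem realize_rel (θ : Con L A) {X : Type w} (t : L.Term X) (x y : X → A)
    (h : ∀ i, θ.Rel (x i) (y i)) : θ.Rel (t.realize x) (t.realize y) := by
  induction t with
  | var i => exact h i
  | func f ts ih => exact θ.funMap_rel f _ _ ih

/-- The inverse image `(f × f)⁻¹(θ)`. -/
def comap (f : A →[L] B) (θ : Con L B) : Con L A where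
  r a b := θ.Rel (f a) (f b)
  iseqv := ⟨fun _ => θ.refl _, θ.symm, θ.trans⟩
  funMap_rel g x y h := by
    rw [Hom.map_fun, Hom.map_fun]
    exact θ.funMap_rel g _ _ h

/-- The intersection of a set of congruences. -/
def inter (s : Set (Con L A)) : Con L A where
  r a b := ∀ θ ∈ s, θ.Rel a b
  iseqv := ⟨fun a θ _ => θ.refl a, fun h θ hθ => θ.symm (h θ hθ),
    fun h h' θ hθ => θ.trans (h θ hθ) (h' θ hθ)⟩
  funMap_rel f x y h θ hθ := θ.funMap_rel f x y fun i => h i θ hθ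

/-- The union of a directed set of congruences. -/
def union (s : Set (Con L A)) (hne : s.Nonempty) (hd : DirectedOn (· ≤ ·) s) : Con L A where
  r a b := ∃ θ ∈ s, θ.Rel a b
  iseqv := by
    refine ⟨fun a => ?_, fun ⟨θ, hθ, h⟩ => ⟨θ, hθ, θ.symm h⟩, ?_⟩
    · obtain ⟨θ, hθ⟩ := hne
      exact ⟨θ, hθ, θ.refl a⟩
    · rintro a b c ⟨θ, hθ, h⟩ ⟨θ', hθ', h'⟩
      obtain ⟨ρ, hρ, h1, h2⟩ := hd θ hθ θ' hθ'
      exact ⟨ρ, hρ, ρ.trans (h1 _ _ h) (h2 _ _ h')⟩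
  funMap_rel {n} f x y h := by
    choose g hg hr using h
    haveI : Nonempty s := hne.to_subtype
    obtain ⟨ρ, hρ⟩ := (directedOn_iff_directed.1 hd).finite_le (fun i : Fin n => (⟨g i, hg i⟩ : s))
    exact ⟨ρ.1, ρ.2, ρ.1.funMap_rel f x y fun i => hρ i _ _ (hr i)⟩

/-- The quotient `A/θ`, with the induced operations. -/
instance prestructure (θ : Con L A) : L.Prestructure θ.toSetoid where
  toStructure := inferInstance
  fun_equiv x y h := θ.funMap_rel _ x y h
  rel_equiv {_} r := isEmptyElim r

/-- The quotient algebra `A/θ`. -/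
def quotient (θ : Con L A) : Bundled.{u} L.Structure := Bundled.of (Quotient θ.toSetoid)

/-- `θ` is compatible with `F`. -/
def Compatible (θ : Con L A) (F : Set A) : Prop := ∀ a b, a ∈ F → θ.Rel a b → b ∈ F

end Con

section Leibniz

variable {A : Type u} [L.Structure A]

/-- There is a greatest congruence compatible with a given subset. -/
theorem exists_greatest_compatible (F : Set A) :
    ∃ θ : Con L A, IsGreatest {θ : Con L A | θ.Compatible F} θ := by
  classical
  -- unary polynomials, given as terms with parameters
  let R : A → A → Prop := fun a b => ∀ t : L.Term (Option A),
    t.realize (fun o => o.elim a id) ∈ F ↔ t.realize (fun o => o.elim b id) ∈ F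
  have key : ∀ {n : ℕ} (f : L.Functions n) (x y : Fin n → A), (∀ i, R (x i) (y i)) →
      R (funMap f x) (funMap f y) := by
    intro n f x y h t
    have step : ∀ s : Finset (Fin n),
        (t.realize (fun o => o.elim (funMap f x) id) ∈ F ↔
          t.realize (fun o => o.elim (funMap f (fun j => if j ∈ s then y j else x j)) id) ∈ F) := by
      intro s
      induction s using Finset.induction_on with
      | empty => simp
      | insert i s hi ih =>
        rw [ih]
        let z : Fin n → A := fun j => if j ∈ s then y j else x j
        let inner : L.Term (Option A) := Term.func f (fun j =>
          if j = i then Term.var none else Term.var (some (z j)))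
        let t' : L.Term (Option A) := t.subst (fun o => o.elim inner (fun a => Term.var (some a)))
        have ht' : ∀ c : A, t'.realize (fun o => o.elim c id) =
            t.realize (fun o => o.elim (funMap f (fun j => if j = i then c else z j)) id) := by
          intro c
          simp only [t', Term.realize_subst]
          congr 1
          funext o
          cases o with
          | none =>
            simp only [inner, Option.elim, Term.realize]
            congr 1
            funext j
            by_cases hj : j = i <;> simp [hj, Term.realize]
          | some a => simp [Term.realize]
        have hR := h i t'
        rw [ht', ht'] at hR
        have e1 : (fun j => if j = i then x i else z j) = (fun j => if j ∈ s then y j else x j) := by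
          funext j
          by_cases hj : j = i
          · subst hj; simp [hi]
          · simp [hj, z]
        have e2 : (fun j => if j = i then y i else z j) =
            (fun j => if j ∈ insert i s then y j else x j) := by
          funext j
          by_cases hj : j = i
          · subst hj; simp
          · simp [hj, z]
        rw [e1, e2] at hR
        exact hR
    simpa using step Finset.univ
  refine ⟨⟨⟨R, fun a t => Iff.rfl, fun h t => (h t).symm, fun h h' t => (h t).trans (h' t)⟩, key⟩,
    ?_, ?_⟩
  · intro a b ha hab
    exact (hab (Term.var none)).1 ha
  · intro θ hθ a b hab t
    have h : θ.Rel (t.realize (fun o => o.elim a id)) (t.realize (fun o => o.elim b id)) :=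
      θ.realize_rel t _ _ (fun o => by
        cases o with
        | none => exact hab
        | some c => exact θ.refl c)
    exact ⟨fun h' => hθ _ _ h' h, fun h' => hθ _ _ h' (θ.symm h)⟩

variable (L) in
/-- The Leibniz congruence `Ω^A(F)`: the greatest congruence of `A` compatible with `F`. -/
noncomputable def leibniz (F : Set A) : Con L A := (exists_greatest_compatible F).choose

theorem isGreatest_leibniz (F : Set A) :
    IsGreatest {θ : Con L A | θ.Compatible F} (leibniz L F) :=
  (exists_greatest_compatible F).choose_spec

end Leibniz

end Algebra

/-! ## Logics -/

section Logic

variable (L : FirstOrder.Language.{u, v}) [L.IsAlgebraic]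

/-- A logic: a Tarskian (finitary, structural) consequence relation on `Fm(X)`. -/
structure Logic (X : Type u) where
  Entails : Set (L.Term X) → L.Term X → Prop
  reflexivity : ∀ (Γ : Set (L.Term X)) (φ), φ ∈ Γ → Entails Γ φ
  cut : ∀ (Γ Δ : Set (L.Term X)) (φ), Entails Γ φ → (∀ ψ ∈ Γ, Entails Δ ψ) → Entails Δ φ
  monotonicity : ∀ (Γ Δ : Set (L.Term X)) (φ), Γ ⊆ Δ → Entails Γ φ → Entails Δ φ
  finitarity : ∀ (Γ : Set (L.Term X)) (φ), Entails Γ φ →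
    ∃ Δ : Set (L.Term X), Δ ⊆ Γ ∧ Δ.Finite ∧ Entails Δ φ
  structurality : ∀ (Γ : Set (L.Term X)) (φ) (σ : X → L.Term X), Entails Γ φ →
    Entails ((fun γ => γ.subst σ) '' Γ) (φ.subst σ)

variable {L}

/-- `Γ ⊨_K φ ≈ ψ`: equational consequence, for equations with variables in `X`. -/
def EqEntails (K : Set (Bundled.{u} L.Structure)) {X : Type u}
    (Γ : Set (L.Term X × L.Term X)) (e : L.Term X × L.Term X) : Prop :=
  ∀ A ∈ K, ∀ v : X → A.α, letI := A.str
    (∀ g ∈ Γ, g.1.realize v = g.2.realize v) → e.1.realize v = e.2.realize v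

namespace Logic

variable {X : Type u} (l : Logic L X)

/-- The theories of `l`: the deductively closed sets of formulas. -/
def IsTheory (T : Set (L.Term X)) : Prop := ∀ φ, l.Entails T φ → φ ∈ T

/-- The `l`-filters of an algebra `A`. -/
def IsFilter {A : Type u} [L.Structure A] (F : Set A) : Prop :=
  ∀ (Γ : Set (L.Term X)) (φ : L.Term X), l.Entails Γ φ →
    ∀ v : X → A, (∀ γ ∈ Γ, γ.realize v ∈ F) → φ.realize v ∈ F

/-- `Alg*_l`, the class of reduced algebras of `l`: the algebras `A` with an `l`-filter `F` such
that the matrix `⟨A, F⟩` is reduced. -/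
def reducedAlgebras : Set (Bundled.{u} L.Structure) :=
  {A | letI := A.str; ∃ F : Set A.α, l.IsFilter F ∧ leibniz L F = Con.diag L A.α}

/-- `l` is protoalgebraic. -/
def IsProtoalgebraic : Prop :=
  ∀ T : Set (L.Term X), l.IsTheory T → ∀ φ ψ : L.Term X, (leibniz L T).Rel φ ψ →
    l.Entails (T ∪ {φ}) ψ ∧ l.Entails (T ∪ {ψ}) φ

/-- `τ(φ)`, for a set `τ` of equations in one variable: all equations `δ(φ) ≈ ε(φ)`, `δ ≈ ε ∈ τ`. -/
def tauOf (τ : Set (L.Term Unit × L.Term Unit)) (φ : L.Term X) : Set (L.Term X × L.Term X) :=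
  {e | ∃ d ∈ τ, e = (d.1.subst fun _ => φ, d.2.subst fun _ => φ)}

/-- `φ Δ ψ`, for a set `Δ` of formulas in two variables: all formulas `δ(φ, ψ)`, `δ ∈ Δ`. -/
def deltaOf (Δ : Set (L.Term (Fin 2))) (e : L.Term X × L.Term X) : Set (L.Term X) :=
  {χ | ∃ d ∈ Δ, χ = d.subst ![e.1, e.2]}

/-- `l` is algebraizable, in the sense of Blok and Pigozzi, with equivalent algebraic semantics
`K`, defining equations `τ` and equivalence formulas `Δ` (both finite). -/
structure IsAlgebraizableVia (K : Set (Bundled.{u} L.Structure))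
    (τ : Set (L.Term Unit × L.Term Unit)) (Δ : Set (L.Term (Fin 2))) : Prop where
  finite_eqs : τ.Finite
  finite_fmls : Δ.Finite
  /-- `Γ ⊢ φ` iff `τ(Γ) ⊨_K τ(φ)`. -/
  entails_iff : ∀ (Γ : Set (L.Term X)) (φ : L.Term X),
    l.Entails Γ φ ↔ ∀ e ∈ tauOf τ φ, EqEntails K (⋃ γ ∈ Γ, tauOf τ γ) e
  /-- `Γ ⊨_K φ ≈ ψ` iff `{ξ Δ η : ξ ≈ η ∈ Γ} ⊢ φ Δ ψ`. -/
  eqEntails_iff : ∀ (Γ : Set (L.Term X × L.Term X)) (e : L.Term X × L.Term X),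
    EqEntails K Γ e ↔ ∀ χ ∈ deltaOf Δ e, l.Entails (⋃ g ∈ Γ, deltaOf Δ g) χ
  /-- `ψ ⊣⊢ Δ(τ(ψ))`. -/
  inverse : ∀ ψ : L.Term X,
    (∀ χ ∈ ⋃ e ∈ tauOf τ ψ, deltaOf Δ e, l.Entails {ψ} χ) ∧
      l.Entails (⋃ e ∈ tauOf τ ψ, deltaOf Δ e) ψ

/-- `l` is algebraizable with equivalent algebraic semantics `K`. -/
def IsAlgebraizableWith (K : Set (Bundled.{u} L.Structure)) : Prop :=
  ∃ (τ : Set (L.Term Unit × L.Term Unit)) (Δ : Set (L.Term (Fin 2))), l.IsAlgebraizableVia K τ Δ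

end Logic

end Logic

/-! ## Filter pairs -/

section FilterPair

variable (L : FirstOrder.Language.{u, v}) [L.IsAlgebraic]

/-- A filter pair `(G, i)`: a contravariant functor `G` from algebras to algebraic lattices (with
maps preserving arbitrary infima and directed suprema), and a natural transformation `i` from `G` to
the power set functor whose components preserve arbitrary infima and directed suprema. -/
structure FilterPair where
  /-- The lattice `G(A)`. -/
  G : (A : Type u) → [L.Structure A] → Type u
  [lattice : ∀ (A : Type u) [L.Structure A], CompleteLattice (G A)]
  [algebraic : ∀ (A : Type u) [L.Structure A], IsCompactlyGenerated (G A)]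
  /-- The map `G(f)`. -/
  map : ∀ {A B : Type u} [L.Structure A] [L.Structure B], (A →[L] B) → G B → G A
  map_id : ∀ (A : Type u) [L.Structure A] (θ : G A), map (Hom.id L A) θ = θ
  map_comp : ∀ {A B C : Type u} [L.Structure A] [L.Structure B] [L.Structure C]
    (f : A →[L] B) (g : B →[L] C) (θ : G C), map (g.comp f) θ = map f (map g θ)
  map_sInf : ∀ {A B : Type u} [L.Structure A] [L.Structure B] (f : A →[L] B) (s : Set (G B)),
    map f (sInf s) = sInf (map f '' s)
  map_sSup : ∀ {A B : Type u} [L.Structure A] [L.Structure B] (f : A →[L] B) (s : Set (G B)),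
    s.Nonempty → DirectedOn (· ≤ ·) s → map f (sSup s) = sSup (map f '' s)
  /-- The map `i_A`. -/
  i : ∀ {A : Type u} [L.Structure A], G A → Set A
  i_sInf : ∀ {A : Type u} [L.Structure A] (s : Set (G A)), i (sInf s) = ⋂ θ ∈ s, i θ
  i_sSup : ∀ {A : Type u} [L.Structure A] (s : Set (G A)),
    s.Nonempty → DirectedOn (· ≤ ·) s → i (sSup s) = ⋃ θ ∈ s, i θ
  i_natural : ∀ {A B : Type u} [L.Structure A] [L.Structure B] (f : A →[L] B) (θ : G B),
    i (map f θ) = f ⁻¹' i θ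

attribute [instance] FilterPair.lattice FilterPair.algebraic

variable {L}

namespace FilterPair

theorem i_mono (P : FilterPair L) {A : Type u} [L.Structure A] {θ θ' : P.G A} (h : θ ≤ θ') :
    P.i θ ⊆ P.i θ' := by
  have h1 := P.i_sInf {θ, θ'}
  rw [sInf_pair, inf_eq_left.2 h] at h1
  intro a ha
  rw [h1] at ha
  simp only [Set.mem_iInter] at ha
  exact ha θ' (by simp)

/-- The logic with variables in `X` associated to a filter pair:
`Γ ⊢ φ` iff for all `θ ∈ G(Fm(X))`, if `Γ ⊆ i(θ)` then `φ ∈ i(θ)`. -/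
def logic (P : FilterPair L) (X : Type u) : Logic L X where
  Entails Γ φ := ∀ θ : P.G (L.Term X), Γ ⊆ P.i θ → φ ∈ P.i θ
  reflexivity _ _ h _ hθ := hθ h
  cut _ _ _ h h' θ hθ := h θ fun ψ hψ => h' ψ hψ θ hθ
  monotonicity _ _ _ hs h θ hθ := h θ (hs.trans hθ)
  finitarity Γ φ h := by
    classical
    -- the least element of `G(Fm(X))` whose image contains `Δ`
    let gen : Set (L.Term X) → P.G (L.Term X) := fun Δ => sInf {θ | Δ ⊆ P.i θ}
    have hgen : ∀ Δ, Δ ⊆ P.i (gen Δ) := by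
      intro Δ a ha
      simp only [gen, P.i_sInf, Set.mem_iInter]
      exact fun θ hθ => hθ ha
    have hmono : ∀ {Δ Δ'}, Δ ⊆ Δ' → gen Δ ≤ gen Δ' := fun hs =>
      sInf_le_sInf fun θ (hθ : _ ⊆ P.i θ) => hs.trans hθ
    let s : Set (P.G (L.Term X)) := {θ | ∃ Δ : Set (L.Term X), Δ ⊆ Γ ∧ Δ.Finite ∧ θ = gen Δ}
    have hne : s.Nonempty := ⟨gen ∅, ∅, by simp, Set.finite_empty, rfl⟩
    have hd : DirectedOn (· ≤ ·) s := by
      rintro _ ⟨Δ, h1, h2, rfl⟩ _ ⟨Δ', h1', h2', rfl⟩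
      exact ⟨gen (Δ ∪ Δ'), ⟨_, Set.union_subset h1 h1', h2.union h2', rfl⟩,
        hmono Set.subset_union_left, hmono Set.subset_union_right⟩
    have hΓ : Γ ⊆ P.i (sSup s) := by
      intro γ hγ
      have hmem : gen {γ} ∈ s := ⟨{γ}, by simpa using hγ, Set.finite_singleton γ, rfl⟩
      exact P.i_mono (le_sSup hmem) (hgen {γ} rfl)
    have hφ := h _ hΓ
    rw [P.i_sSup s hne hd] at hφ
    simp only [Set.mem_iUnion] at hφ
    obtain ⟨_, ⟨Δ, h1, h2, rfl⟩, hφ⟩ := hφ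
    exact ⟨Δ, h1, h2, fun θ hθ => P.i_mono (sInf_le hθ) hφ⟩
  structurality Γ φ σ h θ hθ := by
    have hnat := P.i_natural (substHom σ) θ
    have h1 : φ ∈ P.i (P.map (substHom σ) θ) := h _ (by
      rw [hnat]
      exact fun γ hγ => hθ ⟨γ, hγ, rfl⟩)
    rw [hnat] at h1
    exact h1

end FilterPair

end FilterPair

/-! ## Quasivarieties, relative congruences and equational filter pairs -/

section Quasivariety

variable (L : FirstOrder.Language.{u, v}) [L.IsAlgebraic]

/-- A quasi-identity `p₁ ≈ q₁ ∧ … ∧ pₙ ≈ qₙ → p ≈ q`. -/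
structure QuasiIdentity where
  premises : List (L.Term ℕ × L.Term ℕ)
  conclusion : L.Term ℕ × L.Term ℕ

variable {L}

/-- The quasi-identity `q` holds in the algebra `A`. -/
def QuasiIdentity.Holds (q : QuasiIdentity L) (A : Type u) [L.Structure A] : Prop :=
  ∀ v : ℕ → A, (∀ e ∈ q.premises, e.1.realize v = e.2.realize v) →
    q.conclusion.1.realize v = q.conclusion.2.realize v

/-- A quasivariety: a class of algebras axiomatized by quasi-identities. -/
def IsQuasivariety (K : Set (Bundled.{u} L.Structure)) : Prop :=
  ∃ Q : Set (QuasiIdentity L), ∀ A : Bundled.{u} L.Structure,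
    A ∈ K ↔ letI := A.str; ∀ q ∈ Q, q.Holds A.α

/-- `Co_K(A)`: the congruences `θ` of `A` with `A/θ ∈ K`, ordered by inclusion. -/
def CoK (K : Set (Bundled.{u} L.Structure)) (A : Type u) [L.Structure A] : Type u :=
  {θ : Con L A // θ.quotient ∈ K}

namespace CoK

variable {K : Set (Bundled.{u} L.Structure)} {A : Type u} [L.Structure A] {B : Type u}
  [L.Structure B]

instance : PartialOrder (CoK K A) := inferInstanceAs (PartialOrder {θ : Con L A // θ.quotient ∈ K})

theorem quotient_holds_iff (θ : Con L A) (q : QuasiIdentity L) :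
    q.Holds (Quotient θ.toSetoid) ↔
      ∀ v : ℕ → A, (∀ e ∈ q.premises, θ.Rel (e.1.realize v) (e.2.realize v)) →
        θ.Rel (q.conclusion.1.realize v) (q.conclusion.2.realize v) := by
  have hq : ∀ (t t' : L.Term ℕ) (v : ℕ → A),
      (t.realize (fun i => (Quotient.mk θ.toSetoid (v i))) =
        t'.realize (fun i => (Quotient.mk θ.toSetoid (v i)))) ↔
          θ.Rel (t.realize v) (t'.realize v) := by
    intro t t' v
    rw [Term.realize_quotient_mk' θ.toSetoid t v, Term.realize_quotient_mk' θ.toSetoid t' v,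
      Quotient.eq]
    rfl
  constructor
  · intro h v hv
    exact (hq _ _ v).1 (h _ fun e he => (hq _ _ v).2 (hv e he))
  · intro h v hv
    obtain ⟨w, rfl⟩ : ∃ w : ℕ → A, v = fun i => Quotient.mk θ.toSetoid (w i) :=
      ⟨fun i => (v i).out, funext fun i => (Quotient.out_eq (v i)).symm⟩
    exact (hq _ _ w).2 (h w fun e he => (hq _ _ w).1 (hv e he))

theorem mem_iff {Q : Set (QuasiIdentity L)}
    (hQ : ∀ A : Bundled.{u} L.Structure, A ∈ K ↔ letI := A.str; ∀ q ∈ Q, q.Holds A.α)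
    (θ : Con L A) : θ.quotient ∈ K ↔ ∀ q ∈ Q, ∀ v : ℕ → A,
      (∀ e ∈ q.premises, θ.Rel (e.1.realize v) (e.2.realize v)) →
        θ.Rel (q.conclusion.1.realize v) (q.conclusion.2.realize v) := by
  rw [hQ]
  exact forall₂_congr fun q _ => quotient_holds_iff θ q

theorem inter_mem (hK : IsQuasivariety K) (s : Set (Con L A)) (hs : ∀ θ ∈ s, θ.quotient ∈ K) :
    (Con.inter s).quotient ∈ K := by
  obtain ⟨Q, hQ⟩ := hK
  rw [mem_iff hQ]
  intro q hq v hv θ hθ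
  exact (mem_iff hQ θ).1 (hs θ hθ) q hq v fun e he => hv e he θ hθ

theorem exists_forall_mem_list {s : Set (Con L A)} (hne : s.Nonempty)
    (hd : DirectedOn (· ≤ ·) s) (l : List (A × A)) (h : ∀ e ∈ l, ∃ θ ∈ s, θ.Rel e.1 e.2) :
    ∃ θ ∈ s, ∀ e ∈ l, θ.Rel e.1 e.2 := by
  induction l with
  | nil =>
    obtain ⟨θ, hθ⟩ := hne
    exact ⟨θ, hθ, by simp⟩
  | cons a l ih =>
    obtain ⟨θ, hθ, h1⟩ := ih fun e he => h e (List.mem_cons_of_mem _ he)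
    obtain ⟨θ', hθ', h2⟩ := h a List.mem_cons_self
    obtain ⟨ρ, hρ, h3, h4⟩ := hd θ hθ θ' hθ'
    refine ⟨ρ, hρ, fun e he => ?_⟩
    rcases List.mem_cons.1 he with rfl | he
    · exact h4 _ _ h2
    · exact h3 _ _ (h1 e he)

theorem union_mem (hK : IsQuasivariety K) (s : Set (Con L A)) (hne : s.Nonempty)
    (hd : DirectedOn (· ≤ ·) s) (hs : ∀ θ ∈ s, θ.quotient ∈ K) :
    (Con.union s hne hd).quotient ∈ K := by
  obtain ⟨Q, hQ⟩ := hK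
  rw [mem_iff hQ]
  intro q hq v hv
  obtain ⟨θ, hθ, h⟩ := exists_forall_mem_list hne hd
    (q.premises.map fun e => (e.1.realize v, e.2.realize v)) (by
      intro e he
      obtain ⟨e', he', rfl⟩ := List.mem_map.1 he
      exact hv e' he')
  exact ⟨θ, hθ, (mem_iff hQ θ).1 (hs θ hθ) q hq v fun e he => h _ (List.mem_map.2 ⟨e, he, rfl⟩)⟩

theorem comap_mem (hK : IsQuasivariety K) (f : A →[L] B) (θ : Con L B) (hθ : θ.quotient ∈ K) :
    (θ.comap f).quotient ∈ K := by
  obtain ⟨Q, hQ⟩ := hK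
  rw [mem_iff hQ] at hθ ⊢
  intro q hq v hv
  have hr : ∀ t : L.Term ℕ, f (t.realize v) = t.realize (f ∘ v) := fun t =>
    (HomClass.realize_term f).symm
  have h := hθ q hq (f ∘ v) (fun e he => by
    have := hv e he
    change θ.Rel (f _) (f _) at this
    rwa [hr, hr] at this)
  change θ.Rel (f _) (f _)
  rwa [hr, hr]

/-- Infima in `Co_K(A)` are intersections. -/
def sInf' (hK : IsQuasivariety K) (s : Set (CoK K A)) : CoK K A :=
  ⟨Con.inter (Subtype.val '' s), inter_mem hK _ (by
    rintro _ ⟨θ, _, rfl⟩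
    exact θ.2)⟩

/-- The complete lattice `Co_K(A)` for a quasivariety `K`. -/
@[reducible]
def completeLattice (hK : IsQuasivariety K) (A : Type u) [L.Structure A] :
    CompleteLattice (CoK K A) :=
  letI : InfSet (CoK K A) := ⟨sInf' hK⟩
  completeLatticeOfInf (CoK K A) (fun s => by
    constructor
    · intro θ hθ a b h
      exact h θ.1 ⟨θ, hθ, rfl⟩
    · intro θ hθ a b h
      rintro _ ⟨ρ, hρ, rfl⟩
      exact hθ hρ a b h)

/-- The inverse image map `Co_K(B) → Co_K(A)` of a homomorphism `A → B`. -/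
def comap (hK : IsQuasivariety K) (f : A →[L] B) (θ : CoK K B) : CoK K A :=
  ⟨θ.1.comap f, comap_mem hK f θ.1 θ.2⟩

theorem sInf_rel (hK : IsQuasivariety K) (s : Set (CoK K A)) (a b : A) :
    letI := completeLattice hK A
    (sInf s).1.Rel a b ↔ ∀ θ ∈ s, θ.1.Rel a b := by
  constructor
  · intro h θ hθ
    exact h θ.1 ⟨θ, hθ, rfl⟩
  · rintro h _ ⟨θ, hθ, rfl⟩
    exact h θ hθ

theorem sSup_rel (hK : IsQuasivariety K) (s : Set (CoK K A)) (hne : s.Nonempty)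
    (hd : DirectedOn (· ≤ ·) s) (a b : A) :
    letI := completeLattice hK A
    (sSup s).1.Rel a b ↔ ∃ θ ∈ s, θ.1.Rel a b := by
  letI := completeLattice hK A
  have hd' : DirectedOn (· ≤ ·) (Subtype.val '' s : Set (Con L A)) := by
    rintro _ ⟨θ, hθ, rfl⟩ _ ⟨θ', hθ', rfl⟩
    obtain ⟨ρ, hρ, h, h'⟩ := hd θ hθ θ' hθ'
    exact ⟨ρ.1, ⟨ρ, hρ, rfl⟩, h, h'⟩
  constructor
  · intro h
    let U : CoK K A := ⟨Con.union (Subtype.val '' s) (hne.image _) hd', union_mem hK _ _ _ (by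
      rintro _ ⟨θ, _, rfl⟩
      exact θ.2)⟩
    have hle : sSup s ≤ U := sSup_le fun θ hθ a b hab => ⟨θ.1, ⟨θ, hθ, rfl⟩, hab⟩
    obtain ⟨_, ⟨θ, hθ, rfl⟩, hr⟩ := hle a b h
    exact ⟨θ, hθ, hr⟩
  · rintro ⟨θ, hθ, h⟩
    exact (le_sSup hθ : θ ≤ sSup s) a b h

theorem isCompactlyGenerated (hK : IsQuasivariety K) (A : Type u) [L.Structure A] :
    letI := completeLattice hK A
    IsCompactlyGenerated (CoK K A) := by
  letI := completeLattice hK A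
  let cg : A → A → CoK K A := fun a b => sInf {θ | θ.1.Rel a b}
  have hcg : ∀ a b, (cg a b).1.Rel a b := fun a b => (sInf_rel hK _ a b).2 fun θ hθ => hθ
  refine ⟨fun θ => ⟨{ρ | ∃ a b, θ.1.Rel a b ∧ ρ = cg a b}, ?_, ?_⟩⟩
  · rintro _ ⟨a, b, _, rfl⟩
    rw [CompleteLattice.isCompactElement_iff_le_of_directed_sSup_le]
    intro s hne hd hle
    obtain ⟨ρ, hρ, h⟩ := (sSup_rel hK s hne hd a b).1 (hle a b (hcg a b))
    exact ⟨ρ, hρ, sInf_le h⟩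
  · apply le_antisymm
    · apply sSup_le
      rintro _ ⟨a, b, h, rfl⟩
      exact sInf_le h
    · intro a b h
      have : cg a b ≤ sSup {ρ | ∃ a b, θ.1.Rel a b ∧ ρ = cg a b} := le_sSup ⟨a, b, h, rfl⟩
      exact this a b (hcg a b)

theorem ext_rel {θ θ' : CoK K A} (h : ∀ a b, θ.1.Rel a b ↔ θ'.1.Rel a b) : θ = θ' :=
  Subtype.ext (Con.ext_rel h)

end CoK

/-- The solution set `{a ∈ A | τ^A(a) ⊆ θ}` of the equations `τ` modulo `θ`. -/
def solutions (τ : Set (L.Term Unit × L.Term Unit)) {A : Type u} [L.Structure A] (θ : Con L A) :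
    Set A :=
  {a | ∀ e ∈ τ, θ.Rel (e.1.realize fun _ => a) (e.2.realize fun _ => a)}

/-- The equational filter pair `(Co_K, i^τ)` of a quasivariety `K` and a finite set `τ` of equations
in one variable: `Co_K` acts on homomorphisms by inverse image, and `i^τ` is given by `τ`, i.e.
`i^τ(θ) = {a ∈ A | τ^A(a) ⊆ θ}` for `θ ∈ Co_K(A)`. -/
def equationalFilterPair (K : Set (Bundled.{u} L.Structure)) (hK : IsQuasivariety K)
    (τ : Set (L.Term Unit × L.Term Unit)) (hτ : τ.Finite) : FilterPair L where
  G A := CoK K A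
  lattice A := CoK.completeLattice hK A
  algebraic A := CoK.isCompactlyGenerated hK A
  map f := CoK.comap hK f
  map_id A _ θ := CoK.ext_rel fun _ _ => Iff.rfl
  map_comp f g θ := CoK.ext_rel fun _ _ => Iff.rfl
  map_sInf f s := CoK.ext_rel fun a b => by
    rw [CoK.sInf_rel hK, Set.forall_mem_image]
    exact CoK.sInf_rel hK s (f a) (f b)
  map_sSup {A B} _ _ f s hne hd := CoK.ext_rel fun a b => by
    have hd' : DirectedOn (· ≤ ·) (CoK.comap hK f '' s) := by
      rintro _ ⟨θ, hθ, rfl⟩ _ ⟨θ', hθ', rfl⟩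
      obtain ⟨ρ, hρ, h, h'⟩ := hd θ hθ θ' hθ'
      exact ⟨_, ⟨ρ, hρ, rfl⟩, fun _ _ x => h _ _ x, fun _ _ x => h' _ _ x⟩
    rw [CoK.sSup_rel hK _ (hne.image _) hd', Set.exists_mem_image]
    exact CoK.sSup_rel hK s hne hd (f a) (f b)
  i θ := solutions τ θ.1
  i_sInf s := by
    ext a
    simp only [solutions, Set.mem_ofPred_eq, Set.mem_iInter, CoK.sInf_rel hK]
    exact ⟨fun h θ hθ e he => h e he θ hθ, fun h e he θ hθ => h θ hθ e he⟩
  i_sSup {A} _ s hne hd := by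
    ext a
    simp only [solutions, Set.mem_ofPred_eq, Set.mem_iUnion, CoK.sSup_rel hK s hne hd]
    constructor
    · intro h
      induction τ, hτ using Set.Finite.induction_on with
      | empty =>
        obtain ⟨θ, hθ⟩ := hne
        exact ⟨θ, hθ, by simp⟩
      | @insert e τ _ _ ih =>
        obtain ⟨θ, hθ, h1⟩ := ih fun e he => h e (Set.mem_insert_of_mem _ he)
        obtain ⟨θ', hθ', h2⟩ := h e (Set.mem_insert _ _)
        obtain ⟨ρ, hρ, h3, h4⟩ := hd θ hθ θ' hθ'
        refine ⟨ρ, hρ, fun e' he' => ?_⟩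
        rcases Set.mem_insert_iff.1 he' with rfl | he'
        · exact h4 _ _ h2
        · exact h3 _ _ (h1 e' he')
    · rintro ⟨θ, hθ, h⟩ e he
      exact ⟨θ, hθ, h e he⟩
  i_natural {A B} _ _ f θ := by
    ext a
    have hr : ∀ t : L.Term Unit, f (t.realize fun _ => a) = t.realize (fun _ => f a) := fun t =>
      (HomClass.realize_term f).symm
    refine forall₂_congr fun e _ => ?_
    change θ.1.Rel (f _) (f _) ↔ _
    rw [hr, hr]

/-- The equation `x ≈ ⊤`, for a constant symbol `⊤`. -/
def eqTop (top : L.Constants) : L.Term Unit × L.Term Unit := (Term.var (), top.term)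

end Quasivariety

end AAL

/-!
The defining equation is `x ≈ ⊤`; the work lies in finding the equivalence formulas `Δ`.

Write `i(θ)` for the `θ`-class of `⊤`.  Protoalgebraicity says that congruences compatible with an
`l`-filter `F` are compatible with every larger `l`-filter (`Logic.compatible_of_subset`): the set
`T` of formulas that become theorems once all variables are identified is a theory, its Leibniz
congruence relates any two variables `p` and `q`, and so `T, p ⊢ q`.  If `A ∈ K`, then `A` has an
`l`-filter `F` with trivial Leibniz congruence.  As `⊤ ∈ F`, the least filter `{⊤}` has trivial
Leibniz congruence as well.  Applied to quotients, these two facts show that `i` reflects inclusion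
of `K`-congruences (`CoK.le_of_solutions_subset`).

Now let `ρ` be the least `K`-congruence of `Fm(p, q)` relating `p` and `q`.  A `K`-congruence `θ`
relates `p` and `q` iff `ρ ≤ θ` iff `i(ρ) ⊆ i(θ)`; that is, in members of `K` the equation `p ≈ q`
is equivalent to the set of equations `χ ≈ ⊤` with `χ ∈ i(ρ)`.  Since directed unions of
`K`-congruences are `K`-congruences, a finite subset `Δ` of `i(ρ)` suffices
(`exists_finite_eq_iff`).  The consequence relation of `l` is that of `K` for equations of the form
`φ ≈ ⊤`, so the three conditions of algebraizability can be checked in the members of `K`.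
-/

namespace AAL

open FirstOrder FirstOrder.Language FirstOrder.Language.Structure CategoryTheory

variable {L : FirstOrder.Language.{u, v}}

/-! ### Evaluation of formulas and the class of `⊤` -/

theorem realize_top (top : L.Constants) {X : Type w} {A : Type u} [L.Structure A] (v : X → A) :
    top.term.realize v = (top : A) :=
  Term.realize_constants

theorem mem_solutions_eqTop {top : L.Constants} {A : Type u} [L.Structure A] {θ : Con L A}
    {a : A} : a ∈ solutions {eqTop top} θ ↔ θ.Rel a (top : A) := by
  simp [solutions, eqTop, Term.realize]

variable [L.IsAlgebraic]

/-- The evaluation homomorphism `Fm(X) → A` extending the map `v : X → A`. -/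
def evalHom {X : Type w} {A : Type u} [L.Structure A] (v : X → A) : L.Term X →[L] A where
  toFun t := t.realize v
  map_fun' _ _ := rfl
  map_rel' r _ := isEmptyElim r

theorem Con.compatible_solutions_eqTop (top : L.Constants) {A : Type u} [L.Structure A]
    (θ : Con L A) : θ.Compatible (solutions {eqTop top} θ) := fun _ _ ha hab =>
  mem_solutions_eqTop.2 (θ.trans (θ.symm hab) (mem_solutions_eqTop.1 ha))

theorem diag_quotient_mem {K : Set (Bundled.{u} L.Structure)} {A : Type u} [L.Structure A]
    (hK : IsQuasivariety K) (hA : Bundled.of (c := L.Structure) A ∈ K) :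
    (Con.diag L A).quotient ∈ K := by
  obtain ⟨Q, hQ⟩ := hK
  rw [CoK.mem_iff hQ]
  exact (hQ (Bundled.of (c := L.Structure) A)).1 hA

/-! ### The logic of `x ≈ ⊤` -/

section TopLogic

variable {K : Set (Bundled.{u} L.Structure)} (hK : IsQuasivariety K) (top : L.Constants)
  (X : Type u)

/-- The logic associated to the equational filter pair of `K` and the equation `x ≈ ⊤`. -/
abbrev topLogic : Logic L X :=
  (equationalFilterPair K hK {eqTop top} (Set.finite_singleton _)).logic X

variable {X}

theorem topLogic_isFilter_solutions {A : Type u} [L.Structure A] {θ : Con L A}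
    (hθ : θ.quotient ∈ K) : (topLogic hK top X).IsFilter (solutions {eqTop top} θ) := by
  intro Γ φ h v hv
  have hcomap : ∀ χ : L.Term X, χ ∈ solutions {eqTop top} (θ.comap (evalHom v)) ↔
      χ.realize v ∈ solutions {eqTop top} θ := fun χ => by
    rw [mem_solutions_eqTop, mem_solutions_eqTop, ← realize_top top v]
    rfl
  exact (hcomap φ).1 (h ⟨θ.comap (evalHom v), CoK.comap_mem hK _ θ hθ⟩
    fun γ hγ => (hcomap γ).2 (hv γ hγ))

/-- `Γ ⊢ φ` iff `φ` takes the value `⊤` whenever all members of `Γ` do, in the members of `K`. -/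
theorem topLogic_entails_iff {Γ : Set (L.Term X)} {φ : L.Term X} :
    (topLogic hK top X).Entails Γ φ ↔
      ∀ (A : Type u) [L.Structure A], Bundled.of (c := L.Structure) A ∈ K →
        ∀ v : X → A, (∀ γ ∈ Γ, γ.realize v = (top : A)) → φ.realize v = (top : A) := by
  constructor
  · intro h A _ hA v hv
    exact mem_solutions_eqTop.1 (topLogic_isFilter_solutions hK top (diag_quotient_mem hK hA) Γ φ h
      v fun γ hγ => mem_solutions_eqTop.2 (hv γ hγ))
  · intro h θ hθ
    -- evaluate at the canonical valuation in `Fm(X)/θ`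
    have key : ∀ χ : L.Term X,
        χ.realize (fun x => Quotient.mk θ.1.toSetoid (Term.var x)) = (top : Quotient θ.1.toSetoid) ↔
          χ ∈ solutions {eqTop top} θ.1 := fun χ => by
      have hvar : ∀ t : L.Term X, t.realize (Term.var : X → L.Term X) = t := fun t => by
        induction t with
        | var x => rfl
        | func f ts ih => exact congrArg (Term.func f) (funext ih)
      rw [mem_solutions_eqTop,
        ← realize_top top (fun x => Quotient.mk θ.1.toSetoid (Term.var x : L.Term X)),
        Term.realize_quotient_mk', Term.realize_quotient_mk', Quotient.eq, hvar, hvar]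
      rfl
    exact (key φ).1 (h (Quotient θ.1.toSetoid) θ.2 _ fun γ hγ => (key γ).2 (hθ hγ))

theorem topLogic_top_mem {A : Type u} [L.Structure A] [Nonempty X] {F : Set A}
    (hF : (topLogic hK top X).IsFilter F) : (top : A) ∈ F := by
  have h : (topLogic hK top X).Entails ∅ top.term :=
    (topLogic_entails_iff hK top).2 fun A _ _ v _ => realize_top top v
  have := hF ∅ top.term h (fun _ => (top : A)) (by simp)
  rwa [realize_top] at this

end TopLogic

/-! ### Consequences of protoalgebraicity -/

/-- In a protoalgebraic logic, compatibility of a congruence with an `l`-filter is inherited by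
larger `l`-filters; that is, the Leibniz operator is monotone. -/
theorem Logic.compatible_of_subset {X : Type u} [Nontrivial X] {l : Logic L X}
    (hl : l.IsProtoalgebraic) {A : Type u} [L.Structure A] {F G : Set A} (hF : l.IsFilter F)
    (hG : l.IsFilter G) (hFG : F ⊆ G) {ρ : Con L A} (hρ : ρ.Compatible F) : ρ.Compatible G := by
  classical
  obtain ⟨p, q, hpq⟩ := exists_pair_ne X
  -- the formulas that become theorems when all variables are replaced by `p`
  let σ : X → L.Term X := fun _ => Term.var p
  let T : Set (L.Term X) := {φ | l.Entails ∅ (φ.subst σ)}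
  have hT : l.IsTheory T := fun φ h =>
    l.cut _ _ _ (l.structurality T φ σ h) (by
      rintro _ ⟨ψ, hψ, rfl⟩
      exact hψ)
  -- identifying all variables does not change whether a formula lies in `T`
  have hker : ((Con.diag L (L.Term X)).comap (substHom σ)).Compatible T := by
    intro φ ψ (hφ : l.Entails ∅ (φ.subst σ)) (h : φ.subst σ = ψ.subst σ)
    change l.Entails ∅ (ψ.subst σ)
    rwa [← h]
  have hrel : (leibniz L T).Rel (Term.var p) (Term.var q) :=
    (isGreatest_leibniz T).2 hker _ _ (rfl : σ p = σ q)
  intro a b ha hab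
  let v : X → A := fun x => if x = p then a else b
  have h := hG _ _ (hl T hT _ _ hrel).1 v (by
    rintro γ (hγ | rfl)
    · apply hFG
      have h1 : γ.realize (fun _ => a) ∈ F := by
        have := hF ∅ _ hγ (fun _ => a) (by simp)
        rwa [Term.realize_subst] at this
      refine hρ _ _ h1 (ρ.realize_rel γ _ _ fun x => ?_)
      by_cases hx : x = p
      · simp only [v, if_pos hx]
        exact ρ.refl a
      · simp only [v, if_neg hx]
        exact hab
    · simpa [v, Term.realize] using ha)
  simpa [v, Term.realize, hpq.symm] using h

/-- The congruence of `A/θ` induced by a congruence of `A` that contains `θ`. -/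
noncomputable def Con.push {A : Type u} [L.Structure A] (θ ρ : Con L A) (h : θ ≤ ρ) :
    Con L (Quotient θ.toSetoid) where
  r x y := ρ.Rel x.out y.out
  iseqv := ⟨fun _ => ρ.refl _, ρ.symm, ρ.trans⟩
  funMap_rel {n} f x y hxy := by
    have hout : ∀ z : Fin n → Quotient θ.toSetoid,
        ρ.Rel (funMap f z).out (funMap f fun i => (z i).out) := fun z => by
      refine h _ _ (Quotient.exact (s := θ.toSetoid) ?_)
      have := funMap_quotient_mk' θ.toSetoid f fun i => (z i).out
      simp only [Quotient.out_eq] at this ⊢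
      exact this
    exact ρ.trans (hout x) (ρ.trans (ρ.funMap_rel f _ _ hxy) (ρ.symm (hout y)))

section Reduced

variable {K : Set (Bundled.{u} L.Structure)} {hK : IsQuasivariety K} {top : L.Constants}
  {X : Type u} [Nontrivial X]

/-- The class of `⊤` determines a `K`-congruence, and passing to it reflects inclusion: `ρ` and `θ`
lie below the Leibniz congruence of the `⊤`-class of `θ`, and that congruence is `θ` itself because
`A/θ` is a reduced algebra. -/
theorem CoK.le_of_solutions_subset (hproto : (topLogic hK top X).IsProtoalgebraic)
    (hred : (topLogic hK top X).reducedAlgebras = K) {A : Type u} [L.Structure A] {ρ θ : Con L A}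
    (hρ : ρ.quotient ∈ K) (hθ : θ.quotient ∈ K)
    (h : solutions {eqTop top} ρ ⊆ solutions {eqTop top} θ) : ρ ≤ θ := by
  have hgr := isGreatest_leibniz (L := L) (solutions {eqTop top} θ)
  have hθΩ : θ ≤ leibniz L (solutions {eqTop top} θ) := hgr.2 (θ.compatible_solutions_eqTop top)
  have hρΩ : ρ ≤ leibniz L (solutions {eqTop top} θ) :=
    hgr.2 (Logic.compatible_of_subset hproto (topLogic_isFilter_solutions hK top hρ)
      (topLogic_isFilter_solutions hK top hθ) h (ρ.compatible_solutions_eqTop top))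
  -- it remains to see that `Ω(i(θ)) ≤ θ`, by passing to the reduced algebra `A/θ`
  have hθred := hθ
  rw [← hred] at hθred
  obtain ⟨F, hF, hdiag⟩ : ∃ F : Set (Quotient θ.toSetoid), (topLogic hK top X).IsFilter F ∧
    leibniz L F = Con.diag L (Quotient θ.toSetoid) := hθred
  -- `{⊤}` is the least filter of `A/θ`
  have hle : solutions {eqTop top} (Con.diag L (Quotient θ.toSetoid)) ⊆ F := by
    intro a ha
    have ha' : a = (top : Quotient θ.toSetoid) := mem_solutions_eqTop.1 ha
    rw [ha']
    exact topLogic_top_mem hK top hF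
  have htop : (top : Quotient θ.toSetoid) = Quotient.mk θ.toSetoid (top : A) := by
    have := Term.realize_quotient_mk' θ.toSetoid (top.term : L.Term Empty) Empty.elim
    rwa [realize_top, realize_top] at this
  have hpush : (Con.push θ _ hθΩ).Compatible
      (solutions {eqTop top} (Con.diag L (Quotient θ.toSetoid))) := by
    intro x y hx hxy
    have hx' : x = Quotient.mk θ.toSetoid (top : A) :=
      (mem_solutions_eqTop.1 hx : x = (top : Quotient θ.toSetoid)).trans htop
    have hx'' : x.out ∈ solutions {eqTop top} θ := by
      refine mem_solutions_eqTop.2 (Quotient.exact (s := θ.toSetoid) ?_)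
      rw [Quotient.out_eq, hx']
    have hy := mem_solutions_eqTop.1 (hgr.1 _ _ hx'' hxy)
    refine mem_solutions_eqTop.2 ?_
    change y = (top : Quotient θ.toSetoid)
    rw [htop, ← Quotient.out_eq y]
    exact Quotient.sound hy
  have hpushF := Logic.compatible_of_subset hproto
    (topLogic_isFilter_solutions hK top (diag_quotient_mem hK hθ)) hF hle hpush
  intro a b hab
  have hout : ∀ c : A, θ.Rel (Quotient.mk θ.toSetoid c).out c := fun c =>
    Quotient.exact (s := θ.toSetoid) (Quotient.out_eq _)
  have hab' : (leibniz L (solutions {eqTop top} θ)).Rel (Quotient.mk θ.toSetoid a).out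
      (Quotient.mk θ.toSetoid b).out :=
    Con.trans _ (hθΩ _ _ (hout a)) (Con.trans _ (hρΩ _ _ hab) (Con.symm _ (hθΩ _ _ (hout b))))
  have hrel : (leibniz L F).Rel (Quotient.mk θ.toSetoid a) (Quotient.mk θ.toSetoid b) :=
    (isGreatest_leibniz F).2 hpushF _ _ hab'
  rw [hdiag] at hrel
  exact Quotient.exact (s := θ.toSetoid) hrel

/-! ### Equivalence formulas -/

/-- In the members of `K`, equality is defined by finitely many equations `χ(p, q) ≈ ⊤`. -/
theorem exists_finite_eq_iff (hproto : (topLogic hK top X).IsProtoalgebraic)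
    (hred : (topLogic hK top X).reducedAlgebras = K) :
    ∃ Δ : Set (L.Term (Fin 2)), Δ.Finite ∧
      ∀ (A : Type u) [L.Structure A], Bundled.of (c := L.Structure) A ∈ K →
        ∀ a b : A, a = b ↔ ∀ χ ∈ Δ, χ.realize ![a, b] = (top : A) := by
  let p : L.Term (Fin 2) := Term.var 0
  let q : L.Term (Fin 2) := Term.var 1
  -- the least `K`-congruence relating `p` and `q`, and the formulas it relates to `⊤`
  let P : Set (Con L (L.Term (Fin 2))) := {θ | θ.quotient ∈ K ∧ θ.Rel p q}
  let E : Set (L.Term (Fin 2)) := solutions {eqTop top} (Con.inter P)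
  -- the least `K`-congruence whose `⊤`-class contains `S`
  let gen : Set (L.Term (Fin 2)) → Con L (L.Term (Fin 2)) := fun S =>
    Con.inter {θ | θ.quotient ∈ K ∧ S ⊆ solutions {eqTop top} θ}
  have hgenK : ∀ S, (gen S).quotient ∈ K := fun S => CoK.inter_mem hK _ fun θ hθ => hθ.1
  have hgen : ∀ S, S ⊆ solutions {eqTop top} (gen S) := fun S χ hχ =>
    mem_solutions_eqTop.2 fun θ hθ => mem_solutions_eqTop.1 (hθ.2 hχ)
  have hmono : ∀ {S S'}, S ⊆ S' → gen S ≤ gen S' := fun hS _ _ h θ hθ =>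
    h θ ⟨hθ.1, hS.trans hθ.2⟩
  -- the `K`-congruences generated by finite subsets of `E` have a directed union, which relates `p`
  -- and `q` since its `⊤`-class contains `E`
  obtain ⟨Δ, hΔE, hΔ, hpq⟩ : ∃ Δ ⊆ E, Δ.Finite ∧ (gen Δ).Rel p q := by
    let s : Set (Con L (L.Term (Fin 2))) := {θ | ∃ S ⊆ E, S.Finite ∧ θ = gen S}
    have hne : s.Nonempty := ⟨_, ∅, Set.empty_subset _, Set.finite_empty, rfl⟩
    have hd : DirectedOn (· ≤ ·) s := by
      rintro _ ⟨S, h1, h2, rfl⟩ _ ⟨S', h1', h2', rfl⟩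
      exact ⟨gen (S ∪ S'), ⟨_, Set.union_subset h1 h1', h2.union h2', rfl⟩,
        hmono Set.subset_union_left, hmono Set.subset_union_right⟩
    have hUK : (Con.union s hne hd).quotient ∈ K := CoK.union_mem hK s hne hd (by
      rintro _ ⟨S, _, _, rfl⟩
      exact hgenK S)
    have hEU : E ⊆ solutions {eqTop top} (Con.union s hne hd) := fun χ hχ =>
      mem_solutions_eqTop.2 ⟨gen {χ}, ⟨{χ}, Set.singleton_subset_iff.2 hχ,
        Set.finite_singleton χ, rfl⟩, mem_solutions_eqTop.1 (hgen {χ} rfl)⟩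
    have hPK : (Con.inter P).quotient ∈ K := CoK.inter_mem hK P fun θ hθ => hθ.1
    obtain ⟨_, ⟨S, hSE, hS, rfl⟩, h⟩ :=
      CoK.le_of_solutions_subset hproto hred hPK hUK hEU p q fun θ hθ => hθ.2
    exact ⟨S, hSE, hS, h⟩
  refine ⟨Δ, hΔ, fun A _ hA a b => ?_⟩
  let θ : Con L (L.Term (Fin 2)) := (Con.diag L A).comap (evalHom ![a, b])
  have hθ : θ.quotient ∈ K := CoK.comap_mem hK _ _ (diag_quotient_mem hK hA)
  have hmem : ∀ χ : L.Term (Fin 2),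
      θ.Rel χ (top : L.Term (Fin 2)) ↔ χ.realize ![a, b] = (top : A) := fun χ => by
    rw [← realize_top top (![a, b])]
    rfl
  constructor
  · intro hab χ hχ
    exact (hmem χ).1 (mem_solutions_eqTop.1 (hΔE hχ) θ ⟨hθ, hab⟩)
  · intro h
    exact hpq θ ⟨hθ, fun χ hχ => mem_solutions_eqTop.2 ((hmem χ).2 (h χ hχ))⟩

end Reduced

/-! ### Algebraizability -/

/-- If the equations `χ(p, q) ≈ ⊤`, `χ ∈ Δ`, define equality in `K`, then `Δ` is a set of
equivalence formulas for the logic of `x ≈ ⊤`. -/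
theorem topLogic_isAlgebraizableVia {K : Set (Bundled.{u} L.Structure)} (hK : IsQuasivariety K)
    (top : L.Constants) (X : Type u) {Δ : Set (L.Term (Fin 2))} (hΔ : Δ.Finite)
    (hiff : ∀ (A : Type u) [L.Structure A], Bundled.of (c := L.Structure) A ∈ K →
      ∀ a b : A, a = b ↔ ∀ χ ∈ Δ, χ.realize ![a, b] = (top : A)) :
    (topLogic hK top X).IsAlgebraizableVia K {eqTop top} Δ := by
  have htau : ∀ φ : L.Term X, Logic.tauOf {eqTop top} φ = {(φ, top.term)} := fun φ => by
    ext e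
    simp only [Logic.tauOf, Set.mem_singleton_iff, exists_eq_left, Set.mem_ofPred_eq]
    have : (top.term : L.Term Unit).subst (fun _ => φ) = top.term :=
      congrArg (Term.func top) (Subsingleton.elim _ _)
    simp [eqTop, this, Term.subst]
  have hdelta : ∀ (A : Type u) [L.Structure A], Bundled.of (c := L.Structure) A ∈ K →
      ∀ (v : X → A) (e : L.Term X × L.Term X), e.1.realize v = e.2.realize v ↔
        ∀ χ ∈ Logic.deltaOf Δ e, χ.realize v = (top : A) := by
    intro A _ hA v e
    have hsub : ∀ d : L.Term (Fin 2), (d.subst ![e.1, e.2]).realize v =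
        d.realize ![e.1.realize v, e.2.realize v] := fun d => by
      rw [Term.realize_subst]
      congr 1
      funext i
      fin_cases i <;> rfl
    rw [hiff A hA]
    constructor
    · rintro h _ ⟨d, hd, rfl⟩
      rw [hsub]
      exact h d hd
    · intro h d hd
      rw [← hsub]
      exact h _ ⟨d, hd, rfl⟩
  refine ⟨Set.finite_singleton _, hΔ, fun Γ φ => ?_, fun Γ e => ?_, fun ψ => ?_⟩
  · rw [topLogic_entails_iff]
    simp only [htau, Set.mem_singleton_iff, forall_eq, EqEntails, Set.mem_iUnion, exists_prop,
      forall_exists_index, and_imp, realize_top]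
    constructor
    · intro h A hA v
      let := A.str
      intro hv
      exact h A.α hA v fun γ hγ => (hv _ γ hγ rfl).trans (realize_top top v)
    · intro h A _ hA v hv
      refine h (Bundled.of A) hA v ?_
      rintro _ γ hγ rfl
      exact (hv γ hγ).trans (realize_top top v).symm
  · simp only [topLogic_entails_iff, Set.mem_iUnion, exists_prop, forall_exists_index, and_imp]
    constructor
    · intro h χ hχ A _ hA v hv
      exact (hdelta A hA v e).1 (h (Bundled.of (c := L.Structure) A) hA v fun g hg =>
        (hdelta A hA v g).2 fun ξ hξ => hv ξ g hg hξ) χ hχ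
    · intro h A hA v
      let := A.str
      intro hv
      exact (hdelta A.α hA v e).2 fun χ hχ => h χ hχ A.α hA v fun ξ g hg hξ =>
        (hdelta A.α hA v g).1 (hv g hg) ξ hξ
  · simp only [htau, Set.mem_singleton_iff, Set.iUnion_iUnion_eq_left, topLogic_entails_iff,
      forall_eq]
    constructor
    · intro χ hχ A _ hA v hv
      exact (hdelta A hA v (ψ, top.term)).1 (hv.trans (realize_top top v).symm) χ hχ
    · intro A _ hA v hv
      exact ((hdelta A hA v (ψ, top.term)).2 hv).trans (realize_top top v)

end AAL

theorem proposition4p16 {L : FirstOrder.Language.{u, v}} [L.IsAlgebraic] (top : L.Constants)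
    (K : Set (CategoryTheory.Bundled.{u} L.Structure)) (hK : AAL.IsQuasivariety K)
    (X : Type u) [Infinite X] (l : AAL.Logic L X)
    (hl : l = (AAL.equationalFilterPair K hK {AAL.eqTop top} (Set.finite_singleton _)).logic X)
    (hproto : l.IsProtoalgebraic) (hred : l.reducedAlgebras = K) :
    l.IsAlgebraizableWith K := by
  subst hl
  obtain ⟨Δ, hΔ, hiff⟩ := AAL.exists_finite_eq_iff hproto hred
  exact ⟨_, Δ, AAL.topLogic_isAlgebraizableVia hK top X hΔ hiff⟩
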